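/- **Theorem (privacy guarantee of the expected-averaged subsampled Gaussian mechanism, EASGM).** *Trade-off functions.* A (randomized) rejection rule on a measurable space $\Omega$ is a measurable $\varphi:\Omega\to[0,1]$. For probability measures $P,Q$ on $\Omega$ and $\alpha\in[0,1]$ let $$T(P,Q)(\alpha)=\inf\Big\{\int(1-\varphi)\,dQ \;:\; \varphi \text{ a rejection rule},\ \int\varphi\,dP\le\alpha\Big\}.$$ *Mechanism.* Let $n,N\ge 1$ be integers, $q\in[0,1]$, $\sigma>0$, $C>0$. Let $g$ assign to each record $d$ a vector $g(d)\in\mathbb R^n$, and let $\bar g(d)=g(d)/\max(1,\|g(d)\|_2/C)$. For a dataset $D=(d_1,\dots,d_M)$, let $\mathcal M(D)$ be the law of $$\frac{1}{Mq}\Big(\sum_{i\in B}\bar g(d_i)+G\Big),$$ where $B\subseteq\{1,\dots,M\}$ contains each index independently with probability $q$, and $G\sim\mathcal N(0,\sigma^2C^2 I_n)$ is independent of $B$. When $Mq=0$ the factor $Mq$ is replaced by $1$. *Worst-case components.* Let $P=\mathcal N(0,1)$, $Q_N^{\mu}=\mathcal N\big(\mu,(\tfrac{N}{N+1})^2\big)$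 and $Q_N=Q_N^0$. For $B\subseteq\{1,\dots,N\}$ put $P(B)=q^{|B|}(1-q)^{N-|B|}$, $$\bar\mu_B^1=\frac{|B|}{(N+1)\sigma},\qquad \bar\mu_B^2=\frac{N+|B|}{(N+1)\sigma},\qquad \underline f_B^{\,i}=T\big(P^{\otimes n},\,Q_N^{\otimes(n-1)}\otimes Q_N^{\bar\mu_B^i}\big)\quad(i=1,2).$$ Let $L_B^i$ be the likelihood ratio of $Q_N^{\otimes(n-1)}\otimes Q_N^{\bar\mu_B^i}$ with respect to $P^{\otimes n}$. For $t\in\mathbb R$ and $c\in[0,1]$ put $$\alpha_B^i(t,c)=P^{\otimes n}(L_B^i>t)+c\,P^{\otimes n}(L_B^i=t),\qquad \alpha(t,c)=\sum_{B}P(B)\big[(1-q)\,\alpha_B^1(t,c)+q\,\alpha_B^2(t,c)\big].$$ *Claim.* For all $N,n\ge1$, $q\in[0,1]$ and $\sigma>0$ there is a function $\underline f$ on $[0,1]$, equal to $T(P',Q')$ for some pair of probability distributions $P',Q'$, such that $$\underline f(\alpha(t,c))=\sum_{B}P(B)\Big[(1-q)\,\underline f_B^{\,1}\big(\alpha_B^1(t,c)\big)+q\,\underline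 f_B^{\,2}\big(\alpha_B^2(t,c)\big)\Big]\qquad\text{for all } t\in\mathbb R,\ c\in[0,1].$$ Every $\alpha\in[0,1]$ equals $\alpha(t,c)$ for some $t\ge0$ and $c\in[0,1]$, so this formula determines $\underline f$ on $[0,1]$. Moreover, for every $C>0$, every assignment $g$ of vectors to records, and every pair of neighbouring datasets $D=(d_1,\dots,d_N)$, $D'=(d_1,\dots,d_N,d_{N+1})$, $$T\big(\mathcal M(D),\mathcal M(D')\big)(\alpha)\ \ge\ \underline f(\alpha)\qquad\text{for all }\alpha\in[0,1].$$ -/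

import Mathlib

open MeasureTheory ProbabilityTheory
open scoped NNReal ENNReal

namespace EASGM

noncomputable section

/-! ### Hypothesis testing and trade-off functions -/

/-- A (possibly randomized) rejection rule: `φ y` is the probability of rejecting the null
hypothesis after observing `y`. -/
def IsRejectionRule {Ω : Type*} [MeasurableSpace Ω] (φ : Ω → ℝ) : Prop :=
  Measurable φ ∧ ∀ y, φ y ∈ Set.Icc (0 : ℝ) 1

/-- Type I error of `φ`: probability of rejecting under the null hypothesis `P`. -/
def typeI {Ω : Type*} [MeasurableSpace Ω] (P : Measure Ω) (φ : Ω → ℝ) : ℝ :=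
  ∫ y, φ y ∂P

/-- Type II error of `φ`: probability of not rejecting under the alternative `Q`. -/
def typeII {Ω : Type*} [MeasurableSpace Ω] (Q : Measure Ω) (φ : Ω → ℝ) : ℝ :=
  ∫ y, (1 - φ y) ∂Q

/-- The trade-off function `T(P, Q)`: the infimum of the type II errors of all rejection rules
whose type I error is at most `α`. -/
def tradeOff {Ω : Type*} [MeasurableSpace Ω] (P Q : Measure Ω) (α : ℝ) : ℝ :=
  sInf {β : ℝ | ∃ φ : Ω → ℝ, IsRejectionRule φ ∧ typeI P φ ≤ α ∧ typeII Q φ = β}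

/-- `f` is (on `[0, 1]`) the trade-off function of some pair of probability distributions. -/
def IsTradeOffFunction (f : ℝ → ℝ) : Prop :=
  ∃ (Ω : Type) (_ : MeasurableSpace Ω) (P Q : Measure Ω),
    IsProbabilityMeasure P ∧ IsProbabilityMeasure Q ∧
      ∀ α ∈ Set.Icc (0 : ℝ) 1, f α = tradeOff P Q α

/-- Type I error of the likelihood ratio test of `P` against `Q` which rejects when the likelihood
ratio `dQ/dP` exceeds `t` and rejects with probability `c` when it equals `t`. -/
def lrtTypeI {Ω : Type*} [MeasurableSpace Ω] (P Q : Measure Ω) (t c : ℝ) : ℝ :=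
  P.real {x | t < (Q.rnDeriv P x).toReal} + c * P.real {x | (Q.rnDeriv P x).toReal = t}

/-! ### The mechanism -/

/-- Clipping of an information vector to norm at most `C`. -/
def clip {n : ℕ} (C : ℝ) (v : EuclideanSpace ℝ (Fin n)) : EuclideanSpace ℝ (Fin n) :=
  (max 1 (‖v‖ / C))⁻¹ • v

/-- The normalization factor `N q`, replaced by `1` when it vanishes. -/
def normFactor (N : ℕ) (q : ℝ) : ℝ :=
  if (N : ℝ) * q = 0 then 1 else N * q

/-- The output distribution of the expected-averaged subsampled Gaussian mechanism on the dataset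
`d 0, …, d (N - 1)`: a batch is drawn by including every index independently with probability `q`,
the clipped information vectors of the batch are summed, independent noise `N(0, σ² C² I)` is
added, and the result is divided by `N q`. -/
def easgm {X : Type*} {n : ℕ} (g : X → EuclideanSpace ℝ (Fin n)) (C σ : ℝ) (q : unitInterval)
    {N : ℕ} (d : Fin N → X) : Measure (EuclideanSpace ℝ (Fin n)) :=
  ((setBernoulli (Set.univ : Set (Fin N)) q).prod
      (multivariateGaussian 0 ((σ ^ 2 * C ^ 2) • (1 : Matrix (Fin n) (Fin n) ℝ)))).map
    (fun p => (normFactor N q)⁻¹ •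
      (∑ i, p.1.indicator (fun j => clip C (g (d j))) i + p.2))

/-! ### The worst-case components -/

/-- `P^{⊗ n}` with `P = N(0, 1)`. -/
def nullLaw (n : ℕ) : Measure (Fin n → ℝ) :=
  Measure.pi (fun _ => gaussianReal 0 1)

/-- `Q_N^{⊗ (n - 1)} ⊗ Q_N^μ`, where `Q_N^μ = N(μ, (N / (N + 1))²)` and `Q_N = Q_N^0`;
the last coordinate is the one with mean `μ`. -/
def altLaw (N n : ℕ) (μ : ℝ) : Measure (Fin n → ℝ) :=
  Measure.pi (fun i => gaussianReal (if (i : ℕ) + 1 = n then μ else 0)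
    (((N : ℝ≥0) / ((N : ℝ≥0) + 1)) ^ 2))

/-- `P(B) = q^|B| (1 - q)^(N - |B|)`. -/
def batchProb {N : ℕ} (q : ℝ) (B : Finset (Fin N)) : ℝ :=
  q ^ B.card * (1 - q) ^ (N - B.card)

/-- The worst-case mean `|B| / ((N + 1) σ)` when the additional record is not sampled. -/
def mean₁ {N : ℕ} (σ : ℝ) (B : Finset (Fin N)) : ℝ :=
  (B.card : ℝ) / (((N : ℝ) + 1) * σ)

/-- The worst-case mean `(N + |B|) / ((N + 1) σ)` when the additional record is sampled. -/
def mean₂ {N : ℕ} (σ : ℝ) (B : Finset (Fin N)) : ℝ :=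
  ((N : ℝ) + (B.card : ℝ)) / (((N : ℝ) + 1) * σ)

/-- `α_B^1(t, c)` for `μ = mean₁ σ B` and `α_B^2(t, c)` for `μ = mean₂ σ B`. -/
def compLevel (N n : ℕ) (μ t c : ℝ) : ℝ :=
  lrtTypeI (nullLaw n) (altLaw N n μ) t c

/-- The lower component trade-off function `T(P^{⊗ n}, Q_N^{⊗ (n - 1)} ⊗ Q_N^μ)`. -/
def compTradeOff (N n : ℕ) (μ : ℝ) : ℝ → ℝ :=
  tradeOff (nullLaw n) (altLaw N n μ)

/-- `α(t, c) = ∑_B P(B) [(1 - q) α_B^1(t, c) + q α_B^2(t, c)]`. -/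
def mixLevel (N n : ℕ) (q σ t c : ℝ) : ℝ :=
  ∑ B : Finset (Fin N), batchProb q B *
    ((1 - q) * compLevel N n (mean₁ σ B) t c + q * compLevel N n (mean₂ σ B) t c)

/-- `∑_B P(B) [(1 - q) f_B^1(α_B^1(t, c)) + q f_B^2(α_B^2(t, c))]`. -/
def mixBound (N n : ℕ) (q σ t c : ℝ) : ℝ :=
  ∑ B : Finset (Fin N), batchProb q B *
    ((1 - q) * compTradeOff N n (mean₁ σ B) (compLevel N n (mean₁ σ B) t c)
      + q * compTradeOff N n (mean₂ σ B) (compLevel N n (mean₂ σ B) t c))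

end

end EASGM

/-!
The bound `f` is the trade-off function of one explicit pair, `worstNull` against `worstAlt`: an
observation of the worst-case components together with the label (the batch `B`, and whether the
additional record is sampled) that selects the component. Its likelihood ratio restricts on each
label to the likelihood ratio of that component, so a likelihood ratio test of the pair consists of
likelihood ratio tests of the components with a common threshold. The Neyman–Pearson lemma
(`HasBoundedDensity.tradeOff_typeI_lrTest`), applied to the pair and to the components, turns this
into the formula for `f (α(t, c))`. The likelihood ratios are bounded because the variance of the
alternative is less than `1`, and therefore every level in `[0, 1]`, including `0`, is attained by a
test with a nonnegative threshold (`HasBoundedDensity.exists_typeI_lrTest_eq`).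

For the mechanism, both output laws are mixtures over the same labels, and a test that does not see
the label is no better than one that does (`tradeOff_mixture_le`). On each label an affine map and a
rotation bring the two Gaussian components to `N(0, I)` and `N(v, s² I)` with `s = N / (N + 1)`, and
clipping bounds `‖v‖` by the worst-case mean (`compTradeOff_le_typeII_component`).

What remains is that the component trade-off function decreases in the mean
(`compTradeOff_le_of_le`). Since `s < 1`, the optimal test for the mean `μ ≥ 0` rejects on a set
that is symmetric and decreasing about a centre with nonnegative last coordinate. Translating it by
`μ' - μ` preserves its power against the mean `μ'` and moves it away from the origin, so that its
level under the standard Gaussian can only drop (`typeI_nullLaw_translate_le`, by a reflection).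
-/

/-! ### Rejection rules and the Neyman–Pearson lemma -/

namespace EASGM

section Tests

variable {Ω : Type*} [MeasurableSpace Ω] {P Q : Measure Ω}

lemma IsRejectionRule.integrable {φ : Ω → ℝ} (h : IsRejectionRule φ) (P : Measure Ω)
    [IsFiniteMeasure P] : Integrable φ P :=
  Integrable.of_bound h.1.aestronglyMeasurable 1 (.of_forall fun y => by
    rw [Real.norm_eq_abs, abs_le]; constructor <;> linarith [(h.2 y).1, (h.2 y).2])

lemma IsRejectionRule.comp {Ω' : Type*} [MeasurableSpace Ω'] {φ : Ω → ℝ} (h : IsRejectionRule φ)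
    {T : Ω' → Ω} (hT : Measurable T) : IsRejectionRule (φ ∘ T) :=
  ⟨h.1.comp hT, fun y => h.2 (T y)⟩

lemma IsRejectionRule.one_sub {φ : Ω → ℝ} (h : IsRejectionRule φ) :
    IsRejectionRule fun y => 1 - φ y :=
  ⟨measurable_const.sub h.1, fun y => ⟨by linarith [(h.2 y).2], by linarith [(h.2 y).1]⟩⟩

lemma isRejectionRule_const {c : ℝ} (hc : c ∈ Set.Icc (0 : ℝ) 1) :
    IsRejectionRule (fun _ : Ω => c) := ⟨measurable_const, fun _ => hc⟩

lemma typeI_mem_Icc (P : Measure Ω) [IsProbabilityMeasure P] {φ : Ω → ℝ}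
    (h : IsRejectionRule φ) : typeI P φ ∈ Set.Icc (0 : ℝ) 1 := by
  refine ⟨integral_nonneg fun y => (h.2 y).1, ?_⟩
  have := integral_mono (h.integrable P) (integrable_const 1) (fun y => (h.2 y).2)
  simpa [typeI] using this

lemma typeII_eq (Q : Measure Ω) [IsProbabilityMeasure Q] {φ : Ω → ℝ}
    (h : IsRejectionRule φ) : typeII Q φ = 1 - typeI Q φ := by
  simp [typeII, typeI, integral_sub (integrable_const 1) (h.integrable Q)]

lemma typeII_nonneg (Q : Measure Ω) {φ : Ω → ℝ} (h : IsRejectionRule φ) : 0 ≤ typeII Q φ :=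
  integral_nonneg fun y => sub_nonneg.2 (h.2 y).2

lemma typeI_map {Ω' : Type*} [MeasurableSpace Ω'] {φ : Ω → ℝ} (h : IsRejectionRule φ)
    {T : Ω' → Ω} (hT : Measurable T) (P : Measure Ω') : typeI (P.map T) φ = typeI P (φ ∘ T) :=
  integral_map hT.aemeasurable h.1.aestronglyMeasurable

lemma typeII_map {Ω' : Type*} [MeasurableSpace Ω'] {φ : Ω → ℝ} (h : IsRejectionRule φ)
    {T : Ω' → Ω} (hT : Measurable T) (Q : Measure Ω') : typeII (Q.map T) φ = typeII Q (φ ∘ T) :=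
  integral_map hT.aemeasurable (measurable_const.sub h.1).aestronglyMeasurable

lemma tradeOff_le {φ : Ω → ℝ} (h : IsRejectionRule φ) {α : ℝ} (hα : typeI P φ ≤ α) :
    tradeOff P Q α ≤ typeII Q φ :=
  csInf_le ⟨0, by rintro _ ⟨ψ, hψ, -, rfl⟩; exact typeII_nonneg Q hψ⟩ ⟨φ, h, hα, rfl⟩

lemma le_tradeOff {α b : ℝ} (hα : 0 ≤ α)
    (h : ∀ φ : Ω → ℝ, IsRejectionRule φ → typeI P φ ≤ α → b ≤ typeII Q φ) :
    b ≤ tradeOff P Q α := by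
  refine le_csInf ⟨_, fun _ => 0, isRejectionRule_const (by simp), by simpa [typeI] using hα, rfl⟩ ?_
  rintro _ ⟨φ, hφ, hφα, rfl⟩
  exact h φ hφ hφα

/-- Rejecting with probability `α` regardless of the observation shows `T(P, Q)(α) ≤ 1 - α`. -/
lemma tradeOff_le_one_sub [IsProbabilityMeasure P] [IsProbabilityMeasure Q] {α : ℝ}
    (hα : α ∈ Set.Icc (0 : ℝ) 1) : tradeOff P Q α ≤ 1 - α := by
  have := tradeOff_le (P := P) (Q := Q) (isRejectionRule_const (Ω := Ω) hα) (α := α)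
    (by simp [typeI])
  simpa [typeII] using this

lemma one_sub_le_tradeOff_self [IsProbabilityMeasure P] {α : ℝ} (hα : 0 ≤ α) :
    1 - α ≤ tradeOff P P α :=
  le_tradeOff hα fun φ hφ h => by rw [typeII_eq P hφ]; linarith

/-- `L` is a nonnegative bounded version of the likelihood ratio `dQ/dP`. -/
structure HasBoundedDensity (P Q : Measure Ω) (L : Ω → ℝ) : Prop where
  measurable : Measurable L
  nonneg : ∀ x, 0 ≤ L x
  bounded : ∃ K, ∀ x, L x ≤ K
  eq_withDensity : Q = P.withDensity fun x => ENNReal.ofReal (L x)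

/-- The likelihood ratio test with threshold `t` that rejects with probability `c` on a tie. -/
noncomputable def lrTest (L : Ω → ℝ) (t c : ℝ) (x : Ω) : ℝ :=
  if t < L x then 1 else if L x = t then c else 0

lemma isRejectionRule_lrTest {L : Ω → ℝ} (hL : Measurable L) (t : ℝ) {c : ℝ}
    (hc : c ∈ Set.Icc (0 : ℝ) 1) : IsRejectionRule (lrTest L t c) := by
  refine ⟨Measurable.ite (measurableSet_lt measurable_const hL) measurable_const
    (Measurable.ite (hL (measurableSet_singleton t)) measurable_const measurable_const),
    fun y => ?_⟩
  unfold lrTest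
  split_ifs <;> simp_all

lemma lrTest_le_lrTest {Ω : Type*} {L : Ω → ℝ} (t : ℝ) {c : ℝ} (hc : c ∈ Set.Icc (0 : ℝ) 1)
    {x y : Ω} (h : L x ≤ L y) : lrTest L t c x ≤ lrTest L t c y := by
  obtain ⟨h0, h1⟩ := hc
  unfold lrTest
  split_ifs with h2 h3 h4 h5 h6 h7 <;>
    first | linarith | exact absurd (le_antisymm (by linarith) (by linarith)) ‹¬L y = t›

lemma typeI_lrTest [IsFiniteMeasure P] {L : Ω → ℝ} (hL : Measurable L) (t c : ℝ) :
    typeI P (lrTest L t c) = P.real {x | t < L x} + c * P.real {x | L x = t} := by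
  have h1 : MeasurableSet {x | t < L x} := measurableSet_lt measurable_const hL
  have h2 : MeasurableSet {x | L x = t} := hL (measurableSet_singleton t)
  have : lrTest L t c = fun x => {x | t < L x}.indicator (fun _ => (1 : ℝ)) x +
      {x | L x = t}.indicator (fun _ => c) x := by
    ext x
    simp only [lrTest, Set.indicator, Set.mem_ofPred_eq]
    split_ifs <;> simp; linarith
  rw [typeI, this, integral_add ((integrable_const _).indicator h1)
    ((integrable_const _).indicator h2), integral_indicator_const _ h1,
    integral_indicator_const _ h2]
  simp [mul_comm]

namespace HasBoundedDensity

variable {L : Ω → ℝ}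

lemma integral_eq (h : HasBoundedDensity P Q L) (ψ : Ω → ℝ) :
    ∫ x, ψ x ∂Q = ∫ x, L x * ψ x ∂P := by
  rw [h.eq_withDensity, integral_withDensity_eq_integral_toReal_smul h.measurable.ennreal_ofReal
    (by simp)]
  simp [ENNReal.toReal_ofReal (h.nonneg _)]

lemma integrable_mul [IsFiniteMeasure P] (h : HasBoundedDensity P Q L) {ψ : Ω → ℝ}
    (hψ : Integrable ψ P) : Integrable (fun x => L x * ψ x) P := by
  obtain ⟨K, hK⟩ := h.bounded
  exact hψ.bdd_mul h.measurable.aestronglyMeasurable (c := K)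
    (.of_forall fun x => by rw [Real.norm_of_nonneg (h.nonneg x)]; exact hK x)

lemma lrtTypeI_eq [IsFiniteMeasure P] (h : HasBoundedDensity P Q L) (t c : ℝ) :
    lrtTypeI P Q t c = typeI P (lrTest L t c) := by
  have hae : ∀ᵐ x ∂P, (Q.rnDeriv P x).toReal = L x := by
    rw [h.eq_withDensity]
    filter_upwards [Measure.rnDeriv_withDensity P h.measurable.ennreal_ofReal] with x hx
    rw [hx, ENNReal.toReal_ofReal (h.nonneg x)]
  rw [typeI_lrTest h.measurable, lrtTypeI]
  congr 1
  · refine measureReal_congr ?_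
    filter_upwards [hae] with x hx
    exact congrArg (t < ·) hx |>.trans rfl
  · congr 1
    refine measureReal_congr ?_
    filter_upwards [hae] with x hx
    exact congrArg (· = t) hx |>.trans rfl

/-- **Neyman–Pearson**: the likelihood ratio test with threshold `t` minimizes the Lagrangian
`typeII + t * typeI`, because it maximizes `ψ x * (L x - t)` at each point `x`. -/
lemma typeII_lrTest_le [IsProbabilityMeasure P] [IsProbabilityMeasure Q]
    (h : HasBoundedDensity P Q L) (t : ℝ) {c : ℝ}
    (hc : c ∈ Set.Icc (0 : ℝ) 1) {ψ : Ω → ℝ} (hψ : IsRejectionRule ψ) :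
    typeII Q (lrTest L t c) ≤ typeII Q ψ + t * (typeI P ψ - typeI P (lrTest L t c)) := by
  have hφ := isRejectionRule_lrTest h.measurable t hc
  have key : ∫ x, (L x * ψ x - t * ψ x) ∂P ≤
      ∫ x, (L x * lrTest L t c x - t * lrTest L t c x) ∂P := by
    refine integral_mono ((h.integrable_mul (hψ.integrable P)).sub ((hψ.integrable P).const_mul t))
      ((h.integrable_mul (hφ.integrable P)).sub ((hφ.integrable P).const_mul t)) fun x => ?_
    obtain ⟨h0, h1⟩ := hψ.2 x
    simp only [lrTest]
    split_ifs with h2 h3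
    · nlinarith
    · simp [h3]
    · have : L x < t := lt_of_le_of_ne (not_lt.1 h2) h3
      nlinarith
  rw [integral_sub (h.integrable_mul (hψ.integrable P)) ((hψ.integrable P).const_mul t),
    integral_sub (h.integrable_mul (hφ.integrable P)) ((hφ.integrable P).const_mul t),
    integral_const_mul, integral_const_mul, ← h.integral_eq, ← h.integral_eq] at key
  rw [typeII_eq Q hψ, typeII_eq Q hφ]
  unfold typeI
  linarith

lemma tradeOff_typeI_lrTest [IsProbabilityMeasure P] [IsProbabilityMeasure Q]
    (h : HasBoundedDensity P Q L) (t : ℝ) {c : ℝ}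
    (hc : c ∈ Set.Icc (0 : ℝ) 1) :
    tradeOff P Q (typeI P (lrTest L t c)) = typeII Q (lrTest L t c) := by
  have hφ := isRejectionRule_lrTest h.measurable t hc
  refine le_antisymm (tradeOff_le hφ le_rfl) (le_tradeOff (typeI_mem_Icc P hφ).1 fun ψ hψ hle => ?_)
  rcases le_or_gt 0 t with ht | ht
  · have := h.typeII_lrTest_le t hc hψ
    nlinarith
  · -- below the threshold `0` the test always rejects
    have : lrTest L t c = fun _ => 1 := by
      ext x
      exact if_pos (ht.trans_le (h.nonneg x))
    rw [this]
    simpa [typeII] using typeII_nonneg Q hψ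

/-- Every level is attained by a likelihood ratio test: the threshold is the upper `α`-quantile of
`L`, and the tie probability splits the atom there. Boundedness of `L` is what allows `α = 0`. -/
lemma exists_typeI_lrTest_eq [IsProbabilityMeasure P] (h : HasBoundedDensity P Q L) {α : ℝ}
    (hα : α ∈ Set.Icc (0 : ℝ) 1) :
    ∃ t c : ℝ, 0 ≤ t ∧ c ∈ Set.Icc (0 : ℝ) 1 ∧ typeI P (lrTest L t c) = α := by
  obtain ⟨K, hK⟩ := h.bounded
  have hm1 (t : ℝ) : MeasurableSet {x | t < L x} := measurableSet_lt measurable_const h.measurable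
  have hcompl (t : ℝ) : P.real {x | L x ≤ t} = 1 - P.real {x | t < L x} := by
    rw [← probReal_compl_eq_one_sub (hm1 t)]
    congr 1
    ext x
    simp
  set S : Set ℝ := {t | 0 ≤ t ∧ P.real {x | t < L x} ≤ α} with hS
  have hSne : S.Nonempty := by
    refine ⟨max K 0, le_max_right _ _, ?_⟩
    have : {x | max K 0 < L x} = ∅ := by
      ext x
      simpa using fun hlt => absurd (hK x) (not_le.2 hlt)
    rw [this]
    simpa using hα.1
  have hSbdd : BddBelow S := ⟨0, fun t ht => ht.1⟩
  set t₀ := sInf S with ht₀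
  have ht₀0 : 0 ≤ t₀ := le_csInf hSne fun t ht => ht.1
  -- right of `t₀` there are points of `S` arbitrarily close
  have hgt : P.real {x | t₀ < L x} ≤ α := by
    obtain ⟨v, hv, hvt, hvlim⟩ := exists_seq_strictAnti_tendsto t₀
    have hU : {x | t₀ < L x} = ⋃ k, {x | v k < L x} := by
      ext x
      simp only [Set.mem_ofPred_eq, Set.mem_iUnion]
      exact ⟨fun hx => (hvlim.eventually (gt_mem_nhds hx)).exists,
        fun ⟨k, hk⟩ => (hvt k).trans hk⟩
    have hmono : Monotone fun k => {x | v k < L x} :=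
      fun i j hij x (hx : v i < L x) => (hv.antitone hij).trans_lt hx
    refine ENNReal.toReal_le_of_le_ofReal hα.1 ?_
    rw [hU, hmono.measure_iUnion]
    refine iSup_le fun k => ?_
    obtain ⟨s, hs, hsv⟩ := exists_lt_of_csInf_lt hSne (hvt k)
    refine (measure_mono fun x (hx : v k < L x) => (hsv.trans hx : s < L x)).trans ?_
    exact (ENNReal.le_ofReal_iff_toReal_le (measure_ne_top _ _) hα.1).2 hs.2
  -- left of `t₀` there is no point of `S`
  have hlt : P.real {x | L x < t₀} ≤ 1 - α := by
    have h1α : 0 ≤ 1 - α := sub_nonneg.2 hα.2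
    obtain ⟨u, hu, hut, hulim⟩ := exists_seq_strictMono_tendsto t₀
    have hU : {x | L x < t₀} = ⋃ k, {x | L x ≤ u k} := by
      ext x
      simp only [Set.mem_ofPred_eq, Set.mem_iUnion]
      exact ⟨fun hx => ((hulim.eventually (lt_mem_nhds hx)).exists).imp fun _ => le_of_lt,
        fun ⟨k, hk⟩ => hk.trans_lt (hut k)⟩
    have hmono : Monotone fun k => {x | L x ≤ u k} :=
      fun i j hij x (hx : L x ≤ u i) => hx.trans (hu.monotone hij)
    refine ENNReal.toReal_le_of_le_ofReal h1α ?_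
    rw [hU, hmono.measure_iUnion]
    refine iSup_le fun k => (ENNReal.le_ofReal_iff_toReal_le (measure_ne_top _ _) h1α).2 ?_
    rcases lt_or_ge (u k) 0 with h0 | h0
    · have : {x | L x ≤ u k} = ∅ := by
        ext x
        simpa using h0.trans_le (h.nonneg x)
      simpa [this] using hα.2
    · have hnot : u k ∉ S := notMem_of_lt_csInf (hut k) hSbdd
      have : α < P.real {x | u k < L x} := by
        by_contra hcon
        exact hnot ⟨h0, not_lt.1 hcon⟩
      change P.real {x | L x ≤ u k} ≤ 1 - α
      rw [hcompl]
      linarith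
  have hsplit : P.real {x | L x ≤ t₀} = P.real {x | L x < t₀} + P.real {x | L x = t₀} := by
    rw [← measureReal_union]
    · congr 1
      ext x
      simp [le_iff_lt_or_eq]
    · exact Set.disjoint_left.2 fun x (h1 : L x < t₀) (h2 : L x = t₀) => h1.ne h2
    · exact h.measurable (measurableSet_singleton t₀)
  rw [hcompl] at hsplit
  have hb0 : 0 ≤ P.real {x | L x = t₀} := measureReal_nonneg
  -- if `L` has no atom at `t₀`, the quotient is the junk value `0`, a correct tie probability
  refine ⟨t₀, (α - P.real {x | t₀ < L x}) / P.real {x | L x = t₀}, ht₀0,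
    ⟨div_nonneg (by linarith) hb0, div_le_one_of_le₀ (by linarith) hb0⟩, ?_⟩
  rw [typeI_lrTest h.measurable]
  rcases hb0.eq_or_lt with hb | hb
  · rw [← hb]
    linarith
  · field_simp
    ring

end HasBoundedDensity

end Tests

/-! ### Mixtures with a visible component label -/

section Mixture

variable {K Ω : Type*} [Fintype K] [MeasurableSpace K] [MeasurableSpace Ω]

/-- The joint law of a label `k`, drawn with probability `w k`, and an observation drawn
from `μ k`. -/
noncomputable def mixture (w : K → ℝ) (μ : K → Measure Ω) : Measure (K × Ω) :=
  ∑ k, ENNReal.ofReal (w k) • (μ k).map (Prod.mk k)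

lemma integral_mixture {w : K → ℝ} (hw : ∀ k, 0 ≤ w k) {μ : K → Measure Ω}
    [∀ k, IsFiniteMeasure (μ k)] {φ : K × Ω → ℝ} (hφ : IsRejectionRule φ) :
    ∫ p, φ p ∂(mixture w μ) = ∑ k, w k * ∫ x, φ (k, x) ∂(μ k) := by
  rw [mixture, integral_finsetSum_measure fun k _ => ?_]
  · refine Finset.sum_congr rfl fun k _ => ?_
    rw [integral_smul_measure, ENNReal.toReal_ofReal (hw k),
      integral_map measurable_prodMk_left.aemeasurable hφ.1.aestronglyMeasurable, smul_eq_mul]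
  · exact (hφ.integrable _).smul_measure ENNReal.ofReal_ne_top

variable {w : K → ℝ} {μ ν : K → Measure Ω}

lemma isProbabilityMeasure_mixture (hw : ∀ k, 0 ≤ w k) (hw1 : ∑ k, w k = 1)
    [∀ k, IsProbabilityMeasure (μ k)] : IsProbabilityMeasure (mixture w μ) := by
  refine ⟨?_⟩
  simp only [mixture, Measure.coe_finsetSum, Finset.sum_apply, Measure.smul_apply, smul_eq_mul,
    Measure.map_apply measurable_prodMk_left MeasurableSet.univ, Set.preimage_univ, measure_univ,
    mul_one]
  rw [← ENNReal.ofReal_sum_of_nonneg fun k _ => hw k, hw1, ENNReal.ofReal_one]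

lemma typeI_mixture (hw : ∀ k, 0 ≤ w k) [∀ k, IsFiniteMeasure (μ k)]
    {φ : K × Ω → ℝ} (hφ : IsRejectionRule φ) :
    typeI (mixture w μ) φ = ∑ k, w k * typeI (μ k) (fun x => φ (k, x)) :=
  integral_mixture hw hφ

lemma typeII_mixture (hw : ∀ k, 0 ≤ w k) [∀ k, IsFiniteMeasure (μ k)]
    {φ : K × Ω → ℝ} (hφ : IsRejectionRule φ) :
    typeII (mixture w μ) φ = ∑ k, w k * typeII (μ k) (fun x => φ (k, x)) :=
  integral_mixture hw (φ := fun p => 1 - φ p)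
    hφ.one_sub

variable [DiscreteMeasurableSpace K]

/-- The likelihood ratio of two mixtures with the same visible label is, on each label, the
likelihood ratio of the components. -/
lemma hasBoundedDensity_mixture {L : K → Ω → ℝ}
    (h : ∀ k, HasBoundedDensity (μ k) (ν k) (L k)) :
    HasBoundedDensity (mixture w μ) (mixture w ν) (fun p => L p.1 p.2) := by
  have hmeas : Measurable fun p : K × Ω => L p.1 p.2 :=
    measurable_from_prod_countable_right fun k => (h k).measurable
  refine ⟨hmeas, fun p => (h p.1).nonneg p.2, ?_, ?_⟩
  · choose M hM using fun k => (h k).bounded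
    exact ⟨∑ k, |M k|, fun p => (hM p.1 p.2).trans ((le_abs_self _).trans
      (Finset.single_le_sum (f := fun k => |M k|) (fun k _ => abs_nonneg _) (Finset.mem_univ p.1)))⟩
  · ext s hs
    rw [withDensity_apply _ hs, ← lintegral_indicator hs, mixture, mixture,
      lintegral_finsetSum_measure, Measure.coe_finsetSum, Finset.sum_apply]
    refine Finset.sum_congr rfl fun k _ => ?_
    have hs' : MeasurableSet (Prod.mk k ⁻¹' s) := measurable_prodMk_left hs
    rw [lintegral_smul_measure, lintegral_map (hmeas.ennreal_ofReal.indicator hs)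
      measurable_prodMk_left, Measure.smul_apply, Measure.map_apply measurable_prodMk_left hs,
      (h k).eq_withDensity, withDensity_apply _ hs', ← lintegral_indicator hs']
    rfl

/-- Testing with a visible label can do no worse than combining the optimal tests of the
components, at whatever levels `a k` are chosen. -/
lemma tradeOff_mixture_le (hw : ∀ k, 0 ≤ w k) [∀ k, IsProbabilityMeasure (μ k)]
    [∀ k, IsProbabilityMeasure (ν k)] {L : K → Ω → ℝ}
    (h : ∀ k, HasBoundedDensity (μ k) (ν k) (L k)) {a : K → ℝ}
    (ha : ∀ k, a k ∈ Set.Icc (0 : ℝ) 1) {α : ℝ} (hα : ∑ k, w k * a k ≤ α) :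
    tradeOff (mixture w μ) (mixture w ν) α ≤ ∑ k, w k * tradeOff (μ k) (ν k) (a k) := by
  choose t c _ hc hlev using fun k => (h k).exists_typeI_lrTest_eq (ha k)
  have hk (k : K) := isRejectionRule_lrTest (h k).measurable (t k) (hc k)
  have hφ : IsRejectionRule fun p : K × Ω => lrTest (L p.1) (t p.1) (c p.1) p.2 :=
    ⟨measurable_from_prod_countable_right fun k => (hk k).1, fun p => (hk p.1).2 p.2⟩
  refine (tradeOff_le hφ ?_).trans_eq ?_
  · rw [typeI_mixture hw hφ]
    exact (Finset.sum_congr rfl fun k _ => congrArg (w k * ·) (hlev k)).trans_le hα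
  · rw [typeII_mixture hw hφ]
    refine Finset.sum_congr rfl fun k _ => congrArg (w k * ·) ?_
    rw [← hlev k, (h k).tradeOff_typeI_lrTest (t k) (hc k)]

end Mixture

/-! ### Gaussian likelihood ratios -/

/-- The likelihood ratio of `N(m, s²)` with respect to `N(0, 1)`. -/
noncomputable def gaussianRatio (s m u : ℝ) : ℝ :=
  s⁻¹ * Real.exp (u ^ 2 / 2 - (u - m) ^ 2 / (2 * s ^ 2))

lemma gaussianRatio_pos {s : ℝ} (hs : 0 < s) (m u : ℝ) : 0 < gaussianRatio s m u := by
  unfold gaussianRatio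
  positivity

lemma measurable_gaussianRatio (s m : ℝ) : Measurable (gaussianRatio s m) := by
  unfold gaussianRatio
  fun_prop

lemma gaussianReal_eq_withDensity_ratio {s : ℝ≥0} (hs : 0 < s) (m : ℝ) :
    gaussianReal m (s ^ 2) =
      (gaussianReal 0 1).withDensity fun u => ENNReal.ofReal (gaussianRatio s m u) := by
  have hs' : (0 : ℝ) < s := hs
  rw [gaussianReal_of_var_ne_zero _ (pow_ne_zero 2 hs.ne'),
    gaussianReal_of_var_ne_zero _ one_ne_zero, ← withDensity_mul _ (measurable_gaussianPDF _ _)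
      (measurable_gaussianRatio _ _).ennreal_ofReal]
  congr 1
  ext u
  rw [Pi.mul_apply, gaussianPDF, gaussianPDF, ← ENNReal.ofReal_mul (gaussianPDFReal_nonneg _ _ _)]
  congr 1
  have h1 : Real.sqrt (2 * Real.pi * (s : ℝ) ^ 2) = Real.sqrt (2 * Real.pi) * s := by
    rw [Real.sqrt_mul (by positivity), Real.sqrt_sq hs'.le]
  simp only [gaussianPDFReal, gaussianRatio, NNReal.coe_pow, NNReal.coe_one, mul_one, sub_zero, h1]
  rw [mul_inv, mul_assoc, mul_assoc, mul_left_comm (Real.exp _), ← Real.exp_add]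
  congr 3
  ring

/-- For a standard deviation below `1` the likelihood ratio is bounded: its exponent is a concave
quadratic, maximal at `m / (1 - s²)`. -/
lemma gaussianRatio_le {s : ℝ} (hs : 0 < s) (hs1 : s < 1) (m u : ℝ) :
    gaussianRatio s m u ≤ s⁻¹ * Real.exp (m ^ 2 / (2 * (1 - s ^ 2))) := by
  have h1 : 0 < 1 - s ^ 2 := by nlinarith
  unfold gaussianRatio
  gcongr
  rw [sub_le_iff_le_add, div_add_div _ _ (by positivity) (by positivity),
    div_le_div_iff₀ (by norm_num) (by positivity)]
  nlinarith [sq_nonneg (u * (1 - s ^ 2) - m)]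

/-- The likelihood ratio of `⊗ᵢ N(mᵢ, s²)` with respect to the standard Gaussian. -/
noncomputable def piGaussianRatio {n : ℕ} (s : ℝ) (m : Fin n → ℝ) (x : Fin n → ℝ) : ℝ :=
  ∏ i, gaussianRatio s (m i) (x i)

lemma measurable_piGaussianRatio {n : ℕ} (s : ℝ) (m : Fin n → ℝ) :
    Measurable (piGaussianRatio s m) :=
  Finset.measurable_prod _ fun i _ => (measurable_gaussianRatio s (m i)).comp (measurable_pi_apply i)

instance (n : ℕ) : IsProbabilityMeasure (nullLaw n) := by
  unfold nullLaw
  infer_instance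

instance (N n : ℕ) (μ : ℝ) : IsProbabilityMeasure (altLaw N n μ) := by
  unfold altLaw
  infer_instance

lemma pi_gaussianReal_eq_withDensity {n : ℕ} {s : ℝ≥0} (hs : 0 < s) (m : Fin n → ℝ) :
    Measure.pi (fun i => gaussianReal (m i) (s ^ 2)) =
      (nullLaw n).withDensity fun x => ENNReal.ofReal (piGaussianRatio s m x) := by
  refine Measure.pi_eq fun t ht => ?_
  have hs' : (0 : ℝ) < s := hs
  have hint (i : Fin n) : Integrable (gaussianRatio s (m i))
      ((gaussianReal 0 1).restrict (t i)) := by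
    refine Integrable.restrict ⟨(measurable_gaussianRatio _ _).aestronglyMeasurable, ?_⟩
    rw [hasFiniteIntegral_iff_ofReal (.of_forall fun u => (gaussianRatio_pos hs' _ u).le),
      ← setLIntegral_univ, ← withDensity_apply _ MeasurableSet.univ,
      ← gaussianReal_eq_withDensity_ratio hs]
    exact measure_lt_top _ _
  simp only [piGaussianRatio]
  rw [withDensity_apply _ (MeasurableSet.univ_pi ht), nullLaw, Measure.restrict_pi_pi,
    ← ofReal_integral_eq_lintegral_ofReal (Integrable.fintype_prod hint)
      (.of_forall fun x => Finset.prod_nonneg fun i _ => (gaussianRatio_pos hs' _ _).le)]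
  rw [integral_fintype_prod_eq_prod (fun i => gaussianRatio s (m i)),
    ENNReal.ofReal_prod_of_nonneg
      fun i _ => integral_nonneg fun u => (gaussianRatio_pos hs' _ u).le]
  refine Finset.prod_congr rfl fun i _ => ?_
  rw [ofReal_integral_eq_lintegral_ofReal (hint i)
      (.of_forall fun u => (gaussianRatio_pos hs' _ u).le),
    ← withDensity_apply _ (ht i), ← gaussianReal_eq_withDensity_ratio hs]

/-- The standard deviation `N / (N + 1)` of the alternative. -/
noncomputable def altSd (N : ℕ) : ℝ≥0 := (N : ℝ≥0) / ((N : ℝ≥0) + 1)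

lemma altSd_pos {N : ℕ} (hN : 1 ≤ N) : 0 < altSd N := by
  have : (0 : ℝ≥0) < N := by exact_mod_cast hN
  unfold altSd
  positivity

lemma coe_altSd (N : ℕ) : (altSd N : ℝ) = N / (N + 1) := by simp [altSd]

lemma altSd_lt_one (N : ℕ) : (altSd N : ℝ) < 1 := by
  rw [coe_altSd, div_lt_one (by positivity)]
  linarith

/-- The mean vector `(0, …, 0, μ)` of the alternative. -/
def altMean (n : ℕ) (μ : ℝ) (i : Fin n) : ℝ := if (i : ℕ) + 1 = n then μ else 0

lemma altLaw_eq (N n : ℕ) (μ : ℝ) :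
    altLaw N n μ = Measure.pi fun i => gaussianReal (altMean n μ i) (altSd N ^ 2) := rfl

lemma hasBoundedDensity_altLaw {N : ℕ} (hN : 1 ≤ N) (n : ℕ) (μ : ℝ) :
    HasBoundedDensity (nullLaw n) (altLaw N n μ) (piGaussianRatio (altSd N) (altMean n μ)) where
  measurable := measurable_piGaussianRatio _ _
  nonneg x := Finset.prod_nonneg fun i _ => (gaussianRatio_pos (altSd_pos hN) _ _).le
  bounded := ⟨_, fun _ => Finset.prod_le_prod
    (fun _ _ => (gaussianRatio_pos (altSd_pos hN) _ _).le)
    fun _ _ => gaussianRatio_le (altSd_pos hN) (altSd_lt_one N) _ _⟩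
  eq_withDensity := by rw [altLaw_eq, pi_gaussianReal_eq_withDensity (altSd_pos hN)]

/-! ### A larger mean is easier to detect -/

lemma pi_gaussianReal_map_add {n : ℕ} (m w : Fin n → ℝ) (v : ℝ≥0) :
    (Measure.pi fun i => gaussianReal (m i) v).map (fun x => x + w) =
      Measure.pi fun i => gaussianReal (m i + w i) v := by
  have := Measure.pi_map_pi (μ := fun i => gaussianReal (m i) v) (f := fun i u => u + w i)
    (hμ := fun i => by rw [gaussianReal_map_add_const]; infer_instance)
    fun i => (measurable_add_const (w i)).aemeasurable
  simp only [gaussianReal_map_add_const] at this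
  exact this

/-- The reflection in the hyperplane where the last coordinate equals `-δ / 2`. -/
def flipLast {n : ℕ} (δ : ℝ) (x : Fin n → ℝ) (i : Fin n) : ℝ :=
  if (i : ℕ) + 1 = n then -δ - x i else x i

lemma measurable_flipLast {n : ℕ} (δ : ℝ) : Measurable (flipLast (n := n) δ) := by
  refine measurable_pi_lambda _ fun i => ?_
  unfold flipLast
  split_ifs <;> fun_prop

lemma flipLast_flipLast {n : ℕ} (δ : ℝ) (x : Fin n → ℝ) : flipLast δ (flipLast δ x) = x := by
  ext i
  unfold flipLast
  split_ifs <;> ring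

/-- The reflection swaps the standard Gaussian with its translate by `-δ` along the last axis. -/
lemma nullLaw_map_flipLast (n : ℕ) (δ : ℝ) :
    (nullLaw n).map (flipLast δ) = Measure.pi fun i => gaussianReal (altMean n (-δ) i) 1 := by
  set f : Fin n → ℝ → ℝ := fun i u => if (i : ℕ) + 1 = n then -δ - u else u with hf
  have hmap (i : Fin n) : (gaussianReal 0 1).map (f i) = gaussianReal (altMean n (-δ) i) 1 := by
    simp only [hf, altMean]
    split_ifs
    · rw [gaussianReal_map_const_sub, sub_zero]
    · exact Measure.map_id
  have := Measure.pi_map_pi (μ := fun _ : Fin n => gaussianReal 0 1) (f := f)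
    (hμ := fun i => by rw [hmap]; infer_instance)
    fun i => Measurable.aemeasurable (by simp only [hf]; split_ifs <;> fun_prop)
  simp only [hmap] at this
  exact this

lemma nullLaw_map_sub_altMean (n : ℕ) (δ : ℝ) :
    (nullLaw n).map (fun x => x - altMean n δ) = (nullLaw n).map (flipLast δ) := by
  rw [nullLaw_map_flipLast, nullLaw]
  simp only [sub_eq_add_neg]
  rw [pi_gaussianReal_map_add]
  congr! 3
  simp only [Pi.neg_apply, altMean, zero_add]
  split_ifs <;> simp

lemma piGaussianRatio_one_altMean {n : ℕ} {i₀ : Fin n} (hi₀ : (i₀ : ℕ) + 1 = n) (δ : ℝ)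
    (x : Fin n → ℝ) :
    piGaussianRatio 1 (altMean n (-δ)) x = Real.exp (-δ * (x i₀ + δ / 2)) := by
  rw [piGaussianRatio, Finset.prod_eq_single i₀]
  · rw [altMean, if_pos hi₀, gaussianRatio, inv_one, one_mul]
    congr 1
    ring
  · intro i _ hi
    have : ¬ (i : ℕ) + 1 = n := fun h => hi (Fin.ext (by omega))
    rw [altMean, if_neg this, gaussianRatio]
    simp
  · simp

/-- For `s < 1` and `0 ≤ μ`, the likelihood ratio of `N(μ, s²)` is symmetric and decreasing about the
nonnegative centre `μ / (1 - s²)`, and for `s = 1` it is nondecreasing; hence, of two points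
symmetric about a nonpositive point, it is at least as large at the right one. -/
lemma gaussianRatio_reflect_le {s δ μ u : ℝ} (hs : 0 < s) (hs1 : s ≤ 1) (hδ : 0 ≤ δ) (hμ : 0 ≤ μ)
    (hu : -δ / 2 ≤ u) : gaussianRatio s μ (-δ - u) ≤ gaussianRatio s μ u := by
  unfold gaussianRatio
  gcongr ?_ * Real.exp ?_
  have hkey : u ^ 2 / 2 - (u - μ) ^ 2 / (2 * s ^ 2) -
      ((-δ - u) ^ 2 / 2 - (-δ - u - μ) ^ 2 / (2 * s ^ 2)) =
      (2 * u + δ) / (2 * s ^ 2) * (δ * (1 - s ^ 2) + 2 * μ) := by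
    field_simp
    ring
  have h1 : 0 ≤ 1 - s ^ 2 := by nlinarith
  have : 0 ≤ (2 * u + δ) / (2 * s ^ 2) * (δ * (1 - s ^ 2) + 2 * μ) :=
    mul_nonneg (div_nonneg (by linarith) (by positivity)) (by positivity)
  linarith

lemma piGaussianRatio_flipLast_le {n : ℕ} {i₀ : Fin n} (hi₀ : (i₀ : ℕ) + 1 = n) {s δ μ : ℝ}
    (hs : 0 < s) (hs1 : s ≤ 1) (hδ : 0 ≤ δ) (hμ : 0 ≤ μ) {x : Fin n → ℝ} (hx : -δ / 2 ≤ x i₀) :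
    piGaussianRatio s (altMean n μ) (flipLast δ x) ≤ piGaussianRatio s (altMean n μ) x := by
  refine Finset.prod_le_prod (fun i _ => (gaussianRatio_pos hs _ _).le) fun i _ => ?_
  unfold flipLast
  split_ifs with h
  · obtain rfl : i = i₀ := Fin.ext (by omega)
    rw [altMean, if_pos h]
    exact gaussianRatio_reflect_le hs hs1 hδ hμ hx
  · rfl

/-- Let `φ` be a rejection rule that, on the right side of the hyperplane of `flipLast δ`, rejects
at least as often as at the mirror points. Translating `φ` by `δ` in the positive direction of the last
axis does not increase its type I error: with `e` the likelihood ratio of the reflected Gaussian,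
`e ≤ 1` exactly on the right side when `δ > 0`, so `(φ - φ ∘ flipLast δ) * (1 - e) ≥ 0`, and the
integral of this product is twice the difference of the two errors. -/
lemma typeI_nullLaw_translate_le {n : ℕ} {i₀ : Fin n} (hi₀ : (i₀ : ℕ) + 1 = n) {δ : ℝ} (hδ : 0 ≤ δ)
    {φ : (Fin n → ℝ) → ℝ} (hφ : IsRejectionRule φ)
    (hflip : ∀ x, -δ / 2 ≤ x i₀ → φ (flipLast δ x) ≤ φ x) :
    typeI (nullLaw n) (fun x => φ (x - altMean n δ)) ≤ typeI (nullLaw n) φ := by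
  set e : (Fin n → ℝ) → ℝ := piGaussianRatio 1 (altMean n (-δ)) with he
  have he_eq (x : Fin n → ℝ) : e x = Real.exp (-δ * (x i₀ + δ / 2)) :=
    piGaussianRatio_one_altMean hi₀ δ x
  have he_meas : Measurable e := measurable_piGaussianRatio _ _
  have hdens : (nullLaw n).map (flipLast δ) = (nullLaw n).withDensity fun x =>
      ENNReal.ofReal (e x) := by
    rw [nullLaw_map_flipLast]
    simpa using pi_gaussianReal_eq_withDensity one_pos (altMean n (-δ))
  have he_nonneg (x : Fin n → ℝ) : 0 ≤ e x := by rw [he_eq]; positivity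
  have he_int : Integrable e (nullLaw n) := by
    refine ⟨he_meas.aestronglyMeasurable, ?_⟩
    rw [hasFiniteIntegral_iff_ofReal (.of_forall he_nonneg), ← setLIntegral_univ,
      ← withDensity_apply _ MeasurableSet.univ, ← hdens]
    have := Measure.isProbabilityMeasure_map (μ := nullLaw n) (measurable_flipLast δ).aemeasurable
    exact measure_lt_top _ _
  have hρ : IsRejectionRule (φ ∘ flipLast δ) := hφ.comp (measurable_flipLast δ)
  have hmul {ψ : (Fin n → ℝ) → ℝ} (hψ : IsRejectionRule ψ) :
      Integrable (fun x => e x * ψ x) (nullLaw n) :=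
    he_int.mul_bdd hψ.1.aestronglyMeasurable (c := 1) (.of_forall fun y => by
      rw [Real.norm_of_nonneg (hψ.2 y).1]; exact (hψ.2 y).2)
  -- change of variables by the reflection, for `φ` and for `φ ∘ flipLast δ`
  have hcv {ψ : (Fin n → ℝ) → ℝ} (hψ : IsRejectionRule ψ) :
      ∫ x, e x * ψ x ∂(nullLaw n) = typeI (nullLaw n) (ψ ∘ flipLast δ) := by
    rw [← typeI_map hψ (measurable_flipLast δ), hdens, typeI,
      integral_withDensity_eq_integral_toReal_smul he_meas.ennreal_ofReal (by simp)]
    simp [ENNReal.toReal_ofReal (he_nonneg _)]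
  have h1 := hcv hφ
  have h2 := hcv hρ
  have h3 : (φ ∘ flipLast δ) ∘ flipLast δ = φ := by
    ext x
    simp [flipLast_flipLast]
  rw [h3] at h2
  have hpos : 0 ≤ ∫ x, ((φ x - e x * φ x) - (φ (flipLast δ x) - e x * φ (flipLast δ x)))
      ∂(nullLaw n) := by
    refine integral_nonneg fun x => ?_
    change 0 ≤ (φ x - e x * φ x) - (φ (flipLast δ x) - e x * φ (flipLast δ x))
    rcases le_total (-δ / 2) (x i₀) with hx | hx
    · have := hflip x hx
      have hle : e x ≤ 1 := by
        rw [he_eq, Real.exp_le_one_iff]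
        nlinarith
      nlinarith
    · have := hflip (flipLast δ x) (by rw [flipLast, if_pos hi₀]; linarith)
      rw [flipLast_flipLast] at this
      have hle : 1 ≤ e x := by
        rw [he_eq, Real.one_le_exp_iff]
        nlinarith
      nlinarith
  have hI {ψ : (Fin n → ℝ) → ℝ} (hψ : IsRejectionRule ψ) := hψ.integrable (nullLaw n)
  have hexp : ∫ x, ((φ x - e x * φ x) - (φ (flipLast δ x) - e x * φ (flipLast δ x)))
      ∂(nullLaw n) = 2 * (typeI (nullLaw n) φ - typeI (nullLaw n) (φ ∘ flipLast δ)) := by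
    have hsub {ψ : (Fin n → ℝ) → ℝ} (hψ : IsRejectionRule ψ) :
        Integrable (fun x => ψ x - e x * ψ x) (nullLaw n) := (hI hψ).sub (hmul hψ)
    have h4 := integral_sub (hsub hφ) (hsub hρ)
    rw [integral_sub (hI hφ) (hmul hφ), integral_sub (hI hρ) (hmul hρ), h1, h2] at h4
    refine h4.trans ?_
    unfold typeI
    ring
  have htr : typeI (nullLaw n) (fun x => φ (x - altMean n δ)) =
      typeI (nullLaw n) (φ ∘ flipLast δ) := by
    rw [← typeI_map hφ (measurable_flipLast δ), ← nullLaw_map_sub_altMean,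
      typeI_map hφ (measurable_sub_const _)]
    rfl
  rw [htr]
  linarith

/-- The component trade-off function decreases as the nonnegative mean grows: translating the
optimal test for `μ` by `μ' - μ` keeps its power and does not increase its level. -/
lemma compTradeOff_le_of_le {N n : ℕ} (hN : 1 ≤ N) (hn : 1 ≤ n) {μ μ' : ℝ} (hμ : 0 ≤ μ)
    (hμμ' : μ ≤ μ') {α : ℝ} (hα : α ∈ Set.Icc (0 : ℝ) 1) :
    compTradeOff N n μ' α ≤ compTradeOff N n μ α := by
  have hd := hasBoundedDensity_altLaw hN n μ
  obtain ⟨t, c, -, hc, hlev⟩ := hd.exists_typeI_lrTest_eq hα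
  set φ := lrTest (piGaussianRatio (altSd N) (altMean n μ)) t c with hφdef
  have hφ : IsRejectionRule φ := isRejectionRule_lrTest hd.measurable t hc
  have hi₀ : ((⟨n - 1, by omega⟩ : Fin n) : ℕ) + 1 = n := Nat.sub_add_cancel hn
  have hδ : 0 ≤ μ' - μ := sub_nonneg.2 hμμ'
  have hm : Measurable fun x : Fin n → ℝ => x - altMean n (μ' - μ) := measurable_sub_const _
  have hle := typeI_nullLaw_translate_le hi₀ hδ hφ fun x hx => lrTest_le_lrTest t hc
    (piGaussianRatio_flipLast_le hi₀ (altSd_pos hN) (altSd_lt_one N).le hδ hμ hx)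
  have hmap : (altLaw N n μ').map (fun x => x - altMean n (μ' - μ)) = altLaw N n μ := by
    simp only [altLaw_eq, sub_eq_add_neg]
    rw [pi_gaussianReal_map_add]
    congr! 3
    simp only [Pi.neg_apply, altMean]
    split_ifs <;> ring
  calc compTradeOff N n μ' α
      ≤ typeII (altLaw N n μ') (φ ∘ fun x => x - altMean n (μ' - μ)) :=
        tradeOff_le (hφ.comp hm) (hle.trans_eq hlev)
    _ = typeII (altLaw N n μ) φ := by rw [← typeII_map hφ hm, hmap]
    _ = compTradeOff N n μ α := by rw [compTradeOff, ← hlev, hd.tradeOff_typeI_lrTest t hc]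

/-! ### Rotating and rescaling a component of the mechanism -/

/-- A linear isometry can turn the last coordinate axis into any prescribed direction. -/
lemma exists_isometry_altMean {n : ℕ} (hn : 1 ≤ n) (v : EuclideanSpace ℝ (Fin n)) :
    ∃ R : EuclideanSpace ℝ (Fin n) ≃ₗᵢ[ℝ] EuclideanSpace ℝ (Fin n),
      R (WithLp.toLp 2 (altMean n ‖v‖)) = v := by
  have hw : WithLp.toLp 2 (altMean n ‖v‖) =
      EuclideanSpace.single (⟨n - 1, by omega⟩ : Fin n) ‖v‖ := by
    ext i
    rw [PiLp.single_apply]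
    exact if_congr (by rw [Fin.ext_iff]; constructor <;> intro h <;> dsimp only at * <;> omega)
      rfl rfl
  refine ⟨(ℝ ∙ (WithLp.toLp 2 (altMean n ‖v‖) - v))ᗮ.reflection, Submodule.reflection_sub ?_⟩
  rw [hw]
  simp

lemma altLaw_eq_map (N n : ℕ) (μ : ℝ) :
    altLaw N n μ = (nullLaw n).map fun x => altMean n μ + (altSd N : ℝ) • x := by
  have hmap (i : Fin n) : (gaussianReal 0 1).map (fun u => altMean n μ i + (altSd N : ℝ) * u) =
      gaussianReal (altMean n μ i) (altSd N ^ 2) := by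
    have : (fun u => altMean n μ i + (altSd N : ℝ) * u) =
        (fun u => altMean n μ i + u) ∘ fun u => (altSd N : ℝ) * u := rfl
    rw [this, ← Measure.map_map (by fun_prop) (by fun_prop), gaussianReal_map_const_mul,
      gaussianReal_map_const_add]
    congr 1
    · ring
    · ext
      simp
  have := Measure.pi_map_pi (μ := fun _ : Fin n => gaussianReal 0 1)
    (f := fun i u => altMean n μ i + (altSd N : ℝ) * u)
    (hμ := fun i => by rw [hmap]; infer_instance)
    fun i => Measurable.aemeasurable (by fun_prop)
  simp only [hmap] at this
  exact this.symm

/-- Testing `a + b G` against `a + b (v + s G)`, with `G` a standard Gaussian vector and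
`s = N / (N + 1)`, is at least as hard as testing the components with mean `‖v‖`, and hence with any
larger mean: a rotation and the map `x ↦ a + b x` carry one pair to the other. -/
lemma compTradeOff_le_typeII {N n : ℕ} (hN : 1 ≤ N) (hn : 1 ≤ n)
    (a v : EuclideanSpace ℝ (Fin n)) (b : ℝ) {μ : ℝ} (hv : ‖v‖ ≤ μ)
    {φ : EuclideanSpace ℝ (Fin n) → ℝ} (hφ : IsRejectionRule φ) :
    compTradeOff N n μ (typeI (stdGaussian (EuclideanSpace ℝ (Fin n))) fun x => φ (a + b • x)) ≤
      typeII (stdGaussian (EuclideanSpace ℝ (Fin n)))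
        fun x => φ (a + b • (v + (altSd N : ℝ) • x)) := by
  obtain ⟨R, hR⟩ := exists_isometry_altMean hn v
  have hRT : Measurable fun x : Fin n → ℝ => R (WithLp.toLp 2 x) := by fun_prop
  have hstd : (nullLaw n).map (fun x : Fin n → ℝ => R (WithLp.toLp 2 x)) =
      stdGaussian (EuclideanSpace ℝ (Fin n)) := by
    have := stdGaussian_map R
    rw [← map_pi_eq_stdGaussian, Measure.map_map (by fun_prop) (by fun_prop)] at this
    rw [map_pi_eq_stdGaussian] at this
    exact this
  have hφa : IsRejectionRule fun x => φ (a + b • x) := hφ.comp (T := fun x => a + b • x) (by fun_prop)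
  have hφb : IsRejectionRule fun x => φ (a + b • (v + (altSd N : ℝ) • x)) :=
    hφ.comp (T := fun x => a + b • (v + (altSd N : ℝ) • x)) (by fun_prop)
  refine (compTradeOff_le_of_le hN hn (norm_nonneg v) hv (typeI_mem_Icc _ hφa)).trans ?_
  rw [← hstd, typeI_map hφa hRT, typeII_map hφb hRT]
  refine (tradeOff_le (hφa.comp hRT) le_rfl).trans_eq ?_
  rw [altLaw_eq_map, typeII_map (hφa.comp hRT) (by fun_prop)]
  congr 1
  ext x
  simp [WithLp.toLp_add, WithLp.toLp_smul, hR]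

/-! ### The mechanism as a finite mixture -/

lemma multivariateGaussian_zero_smul_one {n : ℕ} (r : ℝ) :
    multivariateGaussian 0 (r ^ 2 • (1 : Matrix (Fin n) (Fin n) ℝ)) =
      (stdGaussian (EuclideanSpace ℝ (Fin n))).map fun x => r • x := by
  have hS : (r ^ 2 • (1 : Matrix (Fin n) (Fin n) ℝ)).PosSemidef :=
    Matrix.PosSemidef.one.smul (sq_nonneg r)
  refine Measure.ext_of_charFun ?_
  ext t
  have hdot : t.ofLp ⬝ᵥ (r ^ 2 • (1 : Matrix (Fin n) (Fin n) ℝ)).mulVec t.ofLp =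
      (‖r‖ * ‖t‖) ^ 2 := by
    rw [mul_pow, Real.norm_eq_abs, sq_abs, EuclideanSpace.real_norm_sq_eq, Matrix.smul_mulVec,
      Matrix.one_mulVec, dotProduct_smul, smul_eq_mul]
    simp [dotProduct, pow_two]
  rw [charFun_multivariateGaussian hS, charFun_map_smul, charFun_stdGaussian, norm_smul, hdot]
  congr 1
  simp
  ring

lemma batchProb_nonneg {N : ℕ} (q : unitInterval) (B : Finset (Fin N)) :
    0 ≤ batchProb (q : ℝ) B :=
  mul_nonneg (pow_nonneg q.2.1 _) (pow_nonneg (sub_nonneg.2 q.2.2) _)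

lemma integral_setBernoulli {N : ℕ} (q : unitInterval) (h : Set (Fin N) → ℝ) :
    ∫ S, h S ∂(setBernoulli (Set.univ : Set (Fin N)) q) =
      ∑ B : Finset (Fin N), batchProb (q : ℝ) B * h B := by
  rw [integral_fintype (.of_finite), ← Fintype.finsetEquivSet.sum_comp]
  refine Finset.sum_congr rfl fun B _ => ?_
  rw [Fintype.finsetEquivSet_apply, setBernoulli_real_singleton q (Set.subset_univ _) Set.finite_univ,
    ← Set.compl_eq_univ_sdiff, Set.ncard_compl, Set.ncard_coe_finset, Nat.card_fin, smul_eq_mul]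
  rfl

lemma sum_batchProb {N : ℕ} (q : unitInterval) :
    ∑ B : Finset (Fin N), batchProb (q : ℝ) B = 1 := by
  have := integral_setBernoulli (N := N) q fun _ => 1
  simpa using this.symm

variable {X : Type*} {n : ℕ} {g : X → EuclideanSpace ℝ (Fin n)} {C σ : ℝ}

instance (q : unitInterval) {N : ℕ} (d : Fin N → X) :
    IsProbabilityMeasure (easgm g C σ q d) := by
  refine Measure.isProbabilityMeasure_map (Measurable.aemeasurable ?_)
  exact measurable_from_prod_countable_right fun S => by fun_prop

lemma typeI_easgm (q : unitInterval) {N : ℕ} (d : Fin N → X)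
    {φ : EuclideanSpace ℝ (Fin n) → ℝ} (hφ : IsRejectionRule φ) :
    typeI (easgm g C σ q d) φ = ∑ B : Finset (Fin N), batchProb (q : ℝ) B *
      typeI (stdGaussian (EuclideanSpace ℝ (Fin n))) fun x =>
        φ ((normFactor N q)⁻¹ • (∑ i ∈ B, clip C (g (d i)) + (σ * C) • x)) := by
  have hT : Measurable fun p : Set (Fin N) × EuclideanSpace ℝ (Fin n) => (normFactor N q)⁻¹ •
      (∑ i, p.1.indicator (fun j => clip C (g (d j))) i + p.2) :=
    measurable_from_prod_countable_right fun S => by fun_prop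
  rw [easgm, typeI_map hφ hT, typeI, integral_prod _ ((hφ.comp hT).integrable _),
    integral_setBernoulli]
  refine Finset.sum_congr rfl fun B _ => ?_
  have hB : ∑ i, (B : Set (Fin N)).indicator (fun j => clip C (g (d j))) i =
      ∑ i ∈ B, clip C (g (d i)) := by
    rw [Finset.sum_indicator_eq_sum_filter]
    simp
  have hψ : IsRejectionRule fun y => φ ((normFactor N q)⁻¹ • (∑ i ∈ B, clip C (g (d i)) + y)) :=
    hφ.comp (T := fun y => (normFactor N q)⁻¹ • (∑ i ∈ B, clip C (g (d i)) + y)) (by fun_prop)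
  simp only [Function.comp_def, hB]
  rw [← mul_pow, multivariateGaussian_zero_smul_one]
  exact congrArg _ (typeI_map hψ (by fun_prop) _)

lemma typeII_easgm (q : unitInterval) {N : ℕ} (d : Fin N → X)
    {φ : EuclideanSpace ℝ (Fin n) → ℝ} (hφ : IsRejectionRule φ) :
    typeII (easgm g C σ q d) φ = ∑ B : Finset (Fin N), batchProb (q : ℝ) B *
      typeII (stdGaussian (EuclideanSpace ℝ (Fin n))) fun x =>
        φ ((normFactor N q)⁻¹ • (∑ i ∈ B, clip C (g (d i)) + (σ * C) • x)) :=
  typeI_easgm q d (φ := fun y => 1 - φ y)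
    hφ.one_sub

/-- Splitting the batches of `N + 1` records according to whether the last one is sampled. -/
lemma sum_batchProb_succ {N : ℕ} (q : ℝ) (F : Finset (Fin (N + 1)) → ℝ) :
    ∑ B : Finset (Fin (N + 1)), batchProb q B * F B =
      ∑ B : Finset (Fin N), batchProb q B * ((1 - q) * F (B.map Fin.castSuccEmb) +
        q * F (insert (Fin.last N) (B.map Fin.castSuccEmb))) := by
  have hlast (B : Finset (Fin N)) : Fin.last N ∉ B.map Fin.castSuccEmb := by
    simp [Fin.castSucc_ne_last]
  have hinj : Function.Injective fun B : Finset (Fin N) => B.map Fin.castSuccEmb :=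
    Finset.map_injective _
  rw [← Finset.powerset_univ, Fin.univ_castSuccEmb, Finset.cons_eq_insert,
    Finset.sum_powerset_insert (hlast _), Finset.map_eq_image, Finset.powerset_image,
    Finset.powerset_univ, ← Finset.sum_add_distrib]
  simp only [← Finset.map_eq_image]
  rw [Finset.sum_image hinj.injOn]
  refine Finset.sum_congr rfl fun B _ => ?_
  have hcard : B.card ≤ N := by simpa using B.card_le_univ
  simp only [batchProb, Finset.card_insert_of_notMem (hlast B), Finset.card_map]
  rw [Nat.sub_add_comm hcard, Nat.add_sub_add_right]
  ring

/-! ### The worst-case pair -/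

/-- The label of a component: the batch `B` drawn from the common records, and whether the
additional record is sampled. -/
def Label (N : ℕ) : Type := Finset (Fin N) × Bool

instance (N : ℕ) : Fintype (Label N) := inferInstanceAs (Fintype (Finset (Fin N) × Bool))

instance (N : ℕ) : MeasurableSpace (Label N) := ⊤

instance (N : ℕ) : DiscreteMeasurableSpace (Label N) := ⟨fun _ => trivial⟩

/-- The probability of a label. -/
noncomputable def labelProb {N : ℕ} (q : ℝ) (k : Label N) : ℝ :=
  batchProb q k.1 * bif k.2 then q else 1 - q

/-- The worst-case mean of the component with a given label. -/
noncomputable def labelMean {N : ℕ} (σ : ℝ) (k : Label N) : ℝ :=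
  bif k.2 then mean₂ σ k.1 else mean₁ σ k.1

lemma sum_labelProb_mul {N : ℕ} (q : ℝ) (F : Label N → ℝ) :
    ∑ k, labelProb q k * F k = ∑ B : Finset (Fin N), batchProb q B *
      ((1 - q) * F (B, false) + q * F (B, true)) := by
  refine (Fintype.sum_prod_type (α₁ := Finset (Fin N)) (α₂ := Bool)
    (fun k => labelProb q k * F k)).trans (Finset.sum_congr rfl fun B _ => ?_)
  rw [Fintype.sum_bool]
  simp only [labelProb, cond_true, cond_false]
  ring

lemma labelProb_nonneg {N : ℕ} (q : unitInterval) (k : Label N) : 0 ≤ labelProb (q : ℝ) k := by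
  refine mul_nonneg (batchProb_nonneg q _) ?_
  cases k.2
  · exact sub_nonneg.2 q.2.2
  · exact q.2.1

lemma sum_labelProb {N : ℕ} (q : unitInterval) : ∑ k : Label N, labelProb (q : ℝ) k = 1 := by
  have := sum_labelProb_mul (N := N) (q : ℝ) fun _ => 1
  simpa [sum_batchProb] using this

/-- The null hypothesis of the worst-case pair: a standard Gaussian and an independent label. -/
noncomputable def worstNull (N n : ℕ) (q : ℝ) : Measure (Label N × (Fin n → ℝ)) :=
  mixture (labelProb q) fun _ => nullLaw n

/-- The alternative of the worst-case pair: a label and the Gaussian component it selects. -/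
noncomputable def worstAlt (N n : ℕ) (q σ : ℝ) : Measure (Label N × (Fin n → ℝ)) :=
  mixture (labelProb q) fun k => altLaw N n (labelMean σ k)

instance (N n : ℕ) (q : unitInterval) : IsProbabilityMeasure (worstNull N n q) :=
  isProbabilityMeasure_mixture (labelProb_nonneg q) (sum_labelProb q)

instance (N n : ℕ) (q : unitInterval) (σ : ℝ) : IsProbabilityMeasure (worstAlt N n q σ) :=
  isProbabilityMeasure_mixture (labelProb_nonneg q) (sum_labelProb q)

/-- The likelihood ratio of the worst-case pair. -/
noncomputable def worstRatio (N n : ℕ) (σ : ℝ) (p : Label N × (Fin n → ℝ)) : ℝ :=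
  piGaussianRatio (altSd N) (altMean n (labelMean σ p.1)) p.2

lemma hasBoundedDensity_worst {N : ℕ} (hN : 1 ≤ N) (n : ℕ) (q σ : ℝ) :
    HasBoundedDensity (worstNull N n q) (worstAlt N n q σ) (worstRatio N n σ) :=
  hasBoundedDensity_mixture fun k => hasBoundedDensity_altLaw hN n (labelMean σ k)

/-- `α(t, c)` is the type I error of the likelihood ratio test of the worst-case pair. -/
lemma mixLevel_eq_typeI {N : ℕ} (hN : 1 ≤ N) (n : ℕ) (q : unitInterval) (σ t : ℝ) {c : ℝ}
    (hc : c ∈ Set.Icc (0 : ℝ) 1) :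
    mixLevel N n q σ t c = typeI (worstNull N n q) (lrTest (worstRatio N n σ) t c) := by
  have hφ := isRejectionRule_lrTest (hasBoundedDensity_worst hN n q σ).measurable t hc
  rw [worstNull, typeI_mixture (labelProb_nonneg q) hφ, sum_labelProb_mul]
  simp only [mixLevel, compLevel, (hasBoundedDensity_altLaw hN n _).lrtTypeI_eq]
  rfl

/-- The component bounds add up to the type II error of the likelihood ratio test of the worst-case
pair: its sections are the optimal tests of the components, all with the same threshold. -/
lemma mixBound_eq_typeII {N : ℕ} (hN : 1 ≤ N) (n : ℕ) (q : unitInterval) (σ t : ℝ) {c : ℝ}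
    (hc : c ∈ Set.Icc (0 : ℝ) 1) :
    mixBound N n q σ t c = typeII (worstAlt N n q σ) (lrTest (worstRatio N n σ) t c) := by
  have hφ := isRejectionRule_lrTest (hasBoundedDensity_worst hN n q σ).measurable t hc
  rw [worstAlt, typeII_mixture (labelProb_nonneg q) hφ, sum_labelProb_mul]
  simp only [mixBound, compLevel, compTradeOff, (hasBoundedDensity_altLaw hN n _).lrtTypeI_eq,
    (hasBoundedDensity_altLaw hN n _).tradeOff_typeI_lrTest t hc]
  rfl

/-! ### Comparison of the mechanism with the worst-case pair -/

lemma norm_clip_le {n : ℕ} {C : ℝ} (hC : 0 < C) (v : EuclideanSpace ℝ (Fin n)) :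
    ‖clip C v‖ ≤ C := by
  have hm : 0 < max 1 (‖v‖ / C) := one_pos.trans_le (le_max_left _ _)
  rw [clip, norm_smul, Real.norm_of_nonneg (inv_nonneg.2 hm.le), inv_mul_le_iff₀ hm,
    ← div_le_iff₀ hC]
  exact le_max_right _ _

lemma norm_sum_clip_le {X : Type*} {n N : ℕ} {C : ℝ} (hC : 0 < C)
    (g : X → EuclideanSpace ℝ (Fin n)) (d : Fin N → X) (B : Finset (Fin N)) :
    ‖∑ i ∈ B, clip C (g (d i))‖ ≤ B.card * C := by
  simpa using norm_sum_le_of_le B fun i _ => norm_clip_le hC (g (d i))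

/-- The comparison on one label: `S` is the clipped sum over the common batch and `y` the contribution
of the additional record, which is `0` if that record is not sampled. After recentring at `S / (N q)`
and rescaling, the mechanism compares `N(0, I)` with `N(v, s² I)`, where `s = N / (N + 1)` and
`v = (N y - S) / ((N + 1) σ C)`. -/
lemma compTradeOff_le_typeII_component {N n : ℕ} (hN : 1 ≤ N) (hn : 1 ≤ n) {q σ C μ : ℝ}
    (hq : 0 < q) (hσ : 0 < σ) (hC : 0 < C) {S y : EuclideanSpace ℝ (Fin n)}
    (hμ : (N * ‖y‖ + ‖S‖) / ((N + 1) * σ * C) ≤ μ)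
    {φ : EuclideanSpace ℝ (Fin n) → ℝ} (hφ : IsRejectionRule φ) :
    compTradeOff N n μ (typeI (stdGaussian (EuclideanSpace ℝ (Fin n)))
        fun x => φ ((normFactor N q)⁻¹ • (S + (σ * C) • x))) ≤
      typeII (stdGaussian (EuclideanSpace ℝ (Fin n)))
        fun x => φ ((normFactor (N + 1) q)⁻¹ • (S + y + (σ * C) • x)) := by
  have hN0 : (0 : ℝ) < N := by exact_mod_cast hN
  have h1 : normFactor N q = N * q := if_neg (by positivity)
  have h2 : normFactor (N + 1) q = (N + 1) * q := by
    rw [normFactor, if_neg (by positivity)]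
    push_cast
    rfl
  have hv : ‖((N + 1) * σ * C)⁻¹ • ((N : ℝ) • y - S)‖ ≤ μ := by
    refine le_trans ?_ hμ
    rw [norm_smul, Real.norm_of_nonneg (by positivity), inv_mul_eq_div]
    gcongr
    refine (norm_sub_le _ _).trans_eq ?_
    rw [norm_smul, Real.norm_of_nonneg hN0.le]
  convert compTradeOff_le_typeII hN hn ((N * q)⁻¹ • S) (((N + 1) * σ * C)⁻¹ • ((N : ℝ) • y - S))
    ((N * q)⁻¹ * (σ * C)) hv hφ using 4 with x x
  · rw [h1, smul_add, smul_smul]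
  · rw [h2, coe_altSd]
    match_scalars <;> field_simp; ring

/-- The comparison for `q > 0`: a test against the mechanism, seen on each component, is no better
than the optimal test of the corresponding worst-case component at the same level. -/
lemma tradeOff_worst_le_tradeOff_easgm {N n : ℕ} (hN : 1 ≤ N) (hn : 1 ≤ n) {q : unitInterval}
    (hq : 0 < (q : ℝ)) {σ C : ℝ} (hσ : 0 < σ) (hC : 0 < C) {X : Type*}
    (g : X → EuclideanSpace ℝ (Fin n)) (d : Fin N → X) (dNew : X) {α : ℝ} (hα : 0 ≤ α) :
    tradeOff (worstNull N n q) (worstAlt N n q σ) α ≤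
      tradeOff (easgm g C σ q d) (easgm g C σ q (Fin.snoc d dNew : Fin (N + 1) → X)) α := by
  refine le_tradeOff hα fun φ hφ hφα => ?_
  have hN0 : (0 : ℝ) < N := by exact_mod_cast hN
  set S : Finset (Fin N) → EuclideanSpace ℝ (Fin n) := fun B => ∑ i ∈ B, clip C (g (d i)) with hS
  have hrule (B : Finset (Fin N)) :
      IsRejectionRule fun x => φ ((normFactor N q)⁻¹ • (S B + (σ * C) • x)) :=
    hφ.comp (T := fun x => (normFactor N q)⁻¹ • (S B + (σ * C) • x)) (by fun_prop)
  rw [typeI_easgm q d hφ] at hφα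
  refine (tradeOff_mixture_le (labelProb_nonneg q)
    (fun k : Label N => hasBoundedDensity_altLaw hN n (labelMean σ k))
    (a := fun k => typeI (stdGaussian (EuclideanSpace ℝ (Fin n)))
      fun x => φ ((normFactor N q)⁻¹ • (S k.1 + (σ * C) • x)))
    (fun k => typeI_mem_Icc _ (hrule k.1)) ?_).trans ?_
  · rw [sum_labelProb_mul]
    refine le_trans (le_of_eq (Finset.sum_congr rfl fun B _ => ?_)) hφα
    ring
  · rw [sum_labelProb_mul, typeII_easgm q _ hφ, sum_batchProb_succ]
    have hmap (B : Finset (Fin N)) : ∑ i ∈ B.map Fin.castSuccEmb,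
        clip C (g ((Fin.snoc d dNew : Fin (N + 1) → X) i)) = S B := by
      simp [hS]
    have hins (B : Finset (Fin N)) : ∑ i ∈ insert (Fin.last N) (B.map Fin.castSuccEmb),
        clip C (g ((Fin.snoc d dNew : Fin (N + 1) → X) i)) = S B + clip C (g dNew) := by
      rw [Finset.sum_insert (by simp [Fin.castSucc_ne_last]), hmap, Fin.snoc_last, add_comm]
    refine Finset.sum_le_sum fun B _ => mul_le_mul_of_nonneg_left (add_le_add
      (mul_le_mul_of_nonneg_left ?_ (sub_nonneg.2 q.2.2)) (mul_le_mul_of_nonneg_left ?_ q.2.1))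
      (batchProb_nonneg q B)
    · have := compTradeOff_le_typeII_component (S := S B) (y := 0) (μ := mean₁ σ B)
        hN hn hq hσ hC ?_ hφ
      · simp only [add_zero] at this
        simp only [hmap]
        exact this
      · rw [mean₁, norm_zero, div_le_div_iff₀ (by positivity) (by positivity)]
        have := norm_sum_clip_le hC g d B
        calc (N * 0 + ‖S B‖) * ((N + 1) * σ) ≤ (N * 0 + B.card * C) * ((N + 1) * σ) := by gcongr
          _ = B.card * ((N + 1) * σ * C) := by ring
    · have := compTradeOff_le_typeII_component (S := S B) (y := clip C (g dNew)) (μ := mean₂ σ B)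
        hN hn hq hσ hC ?_ hφ
      · simp only [hins]
        exact this
      · rw [mean₂, div_le_div_iff₀ (by positivity) (by positivity)]
        have := norm_sum_clip_le hC g d B
        have := norm_clip_le hC (g dNew)
        calc (N * ‖clip C (g dNew)‖ + ‖S B‖) * ((N + 1) * σ)
            ≤ (N * C + B.card * C) * ((N + 1) * σ) := by gcongr
          _ = (N + B.card) * ((N + 1) * σ * C) := by ring

/-- Without sampling the mechanism releases pure noise, whatever the dataset. -/
lemma easgm_zero {X : Type*} {n : ℕ} (g : X → EuclideanSpace ℝ (Fin n)) (C σ : ℝ)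
    {N : ℕ} (d : Fin N → X) :
    easgm g C σ 0 d =
      multivariateGaussian 0 ((σ ^ 2 * C ^ 2) • (1 : Matrix (Fin n) (Fin n) ℝ)) := by
  have hT : Measurable fun p : Set (Fin N) × EuclideanSpace ℝ (Fin n) =>
      (normFactor N (0 : unitInterval))⁻¹ •
        (∑ i, p.1.indicator (fun j => clip C (g (d j))) i + p.2) :=
    measurable_from_prod_countable_right fun S => by fun_prop
  rw [easgm, setBernoulli_zero, Measure.dirac_prod, Measure.map_map hT measurable_prodMk_left]
  convert Measure.map_id using 2
  ext1 x
  simp [normFactor]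

end EASGM

theorem mainTheorem1 (N n : ℕ) (hN : 1 ≤ N) (hn : 1 ≤ n) (q : unitInterval) (σ : ℝ) (hσ : 0 < σ) :
    ∃ f : ℝ → ℝ,
      EASGM.IsTradeOffFunction f ∧
      (∀ t c : ℝ, c ∈ Set.Icc (0 : ℝ) 1 →
        f (EASGM.mixLevel N n q σ t c) = EASGM.mixBound N n q σ t c) ∧
      (∀ α ∈ Set.Icc (0 : ℝ) 1, ∃ t c : ℝ,
        0 ≤ t ∧ c ∈ Set.Icc (0 : ℝ) 1 ∧ EASGM.mixLevel N n q σ t c = α) ∧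
      ∀ (X : Type*) (g : X → EuclideanSpace ℝ (Fin n)) (C : ℝ), 0 < C →
        ∀ (d : Fin N → X) (dNew : X), ∀ α ∈ Set.Icc (0 : ℝ) 1,
          f α ≤ EASGM.tradeOff (EASGM.easgm g C σ q d)
            (EASGM.easgm g C σ q (Fin.snoc d dNew : Fin (N + 1) → X)) α := by
  have hd := EASGM.hasBoundedDensity_worst hN n q σ
  refine ⟨EASGM.tradeOff (EASGM.worstNull N n q) (EASGM.worstAlt N n q σ),
    ⟨_, _, _, _, inferInstance, inferInstance, fun _ _ => rfl⟩, fun t c hc => ?_, fun α hα => ?_,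
    fun X g C hC d dNew α hα => ?_⟩
  · rw [EASGM.mixLevel_eq_typeI hN n q σ t hc, EASGM.mixBound_eq_typeII hN n q σ t hc,
      hd.tradeOff_typeI_lrTest t hc]
  · obtain ⟨t, c, ht, hc, h⟩ := hd.exists_typeI_lrTest_eq hα
    exact ⟨t, c, ht, hc, (EASGM.mixLevel_eq_typeI hN n q σ t hc).trans h⟩
  · rcases q.2.1.eq_or_lt with hq | hq
    · -- without sampling the two output laws coincide, and `f α ≤ 1 - α`
      obtain rfl : q = 0 := Subtype.ext hq.symm
      rw [EASGM.easgm_zero, EASGM.easgm_zero]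
      exact (EASGM.tradeOff_le_one_sub hα).trans (EASGM.one_sub_le_tradeOff_self hα.1)
    · exact EASGM.tradeOff_worst_le_tradeOff_easgm hN hn hq hσ hC g d dNew hα.1
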